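/- For a complex $n\times n$ matrix $A$ let $W(A)=\{\langle Ax,x\rangle : x\in\mathbb{C}^n,\ \|x\|=1\}$ be its numerical range and $w(A)=\max\{|z| : z\in W(A)\}$ its numerical radius. $A$ is called accretive if $\Re A=\frac{A+A^*}{2}$ is positive definite. For $0\le\alpha<\frac{\pi}{2}$ write $A\in\mathcal{S}_\alpha$ if $W(A)\subset\{z\in\mathbb{C} : |\Im z|\le \tan\alpha\,\Re z\}$. For accretive $A,B$ and $0<t<1$ the weighted geometric mean is $$A\sharp_t B=\int_0^1\big((1-s)A^{-1}+sB^{-1}\big)^{-1}\,d\nu_t(s),\qquad d\nu_t(s)=\frac{\sin(\pi t)}{\pi}\,s^{t-1}(1-s)^{-t}\,ds,$$ where $\nu_t$ is the probability measure on $[0,1]$ that satisfies $x^t=\int_0^1\big((1-s)+sx^{-1}\big)^{-1}d\nu_t(s)$ for all $x>0$. The Heinz means are $$\mathcal{H}_t(A,B)=\frac{A\sharp_t B+A\sharp_{1-t}B}{2},\qquad \mathcal{H}_t(a,b)=\frac{a^{1-t}b^{t}+a^{t}b^{1-t}}{2}\quad(a,b\ge 0).$$ **Theorem.** Let $0\le\alpha<\frac{\pi}{2}$,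 let $A,B\in\mathcal{S}_\alpha$ be accretive complex $n\times n$ matrices, and let $t\in(0,1)$. Then $$w(\mathcal{H}_t(A,B))\le \sec^3\alpha\;\mathcal{H}_t(w(A),w(B)).$$ -/

import Mathlib

open scoped Matrix ComplexOrder
open MeasureTheory

namespace HeinzSectorial

/-- The numerical range `W(A) = {⟨Ax, x⟩ : ‖x‖ = 1}` of a complex matrix, for the standard inner
product of `ℂⁿ`. (Mathlib's `inner ℂ u v` is conjugate-linear in `u`, so that `inner ℂ x (A x)` is
`⟨Ax, x⟩` in the convention where the inner product is linear in its first argument.) -/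
def numericalRange {n : ℕ} (A : Matrix (Fin n) (Fin n) ℂ) : Set ℂ :=
  {z | ∃ x : EuclideanSpace ℂ (Fin n), ‖x‖ = 1 ∧ inner ℂ x (Matrix.toEuclideanLin A x) = z}

/-- The numerical radius `w(A) = max {|⟨Ax, x⟩| : ‖x‖ = 1}`; for `n ≥ 1` the supremum is attained,
see `isGreatest_numericalRadius`. -/
noncomputable def numericalRadius {n : ℕ} (A : Matrix (Fin n) (Fin n) ℂ) : ℝ :=
  sSup ((fun z : ℂ => ‖z‖) '' numericalRange A)

/-- The sector `S_α = {z : |Im z| ≤ tan α · Re z}`, used for `0 ≤ α < π / 2`. -/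
def sector (α : ℝ) : Set ℂ :=
  {z | |z.im| ≤ Real.tan α * z.re}

/-- The real part `(A + A*) / 2` of a matrix. -/
noncomputable def hermitianPart {n : ℕ} (A : Matrix (Fin n) (Fin n) ℂ) :
    Matrix (Fin n) (Fin n) ℂ :=
  (1 / 2 : ℂ) • (A + Aᴴ)

/-- A matrix is accretive when its real part is positive definite. -/
def IsAccretive {n : ℕ} (A : Matrix (Fin n) (Fin n) ℂ) : Prop :=
  (hermitianPart A).PosDef

/-- The class of matrices whose numerical range lies in the sector `S_α`. -/
def sectorialMatrices (n : ℕ) (α : ℝ) : Set (Matrix (Fin n) (Fin n) ℂ) :=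
  {A | numericalRange A ⊆ sector α}

/-- The weighted harmonic mean `A !_s B = ((1 - s) A⁻¹ + s B⁻¹)⁻¹`. -/
noncomputable def harmonicMean {n : ℕ} (s : ℝ) (A B : Matrix (Fin n) (Fin n) ℂ) :
    Matrix (Fin n) (Fin n) ℂ :=
  (((1 - s : ℝ) : ℂ) • A⁻¹ + (s : ℂ) • B⁻¹)⁻¹

/-- `ν` is a probability measure on `[0, 1]` characterizing the function `f` on `(0, ∞)`, i.e.
`f x = ∫₀¹ ((1 - s) + s x⁻¹)⁻¹ dν(s)` for all `x > 0`. -/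
def IsRepresentingMeasure (f : ℝ → ℝ) (ν : Measure ℝ) : Prop :=
  IsProbabilityMeasure ν ∧ ν (Set.Icc (0 : ℝ) 1)ᶜ = 0 ∧
    ∀ x : ℝ, 0 < x → Integrable (fun s : ℝ => ((1 - s) + s * x⁻¹)⁻¹) ν ∧
      f x = ∫ s, ((1 - s) + s * x⁻¹)⁻¹ ∂ν

/-- The operator mean `∫₀¹ (A !_s B) dν(s)` determined by a measure `ν` on `[0, 1]`; the integral
of the matrix-valued function is taken entrywise. For accretive `A`, `B` the entries are
integrable, see `integrable_harmonicMean`. -/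
noncomputable def operatorMean {n : ℕ} (ν : Measure ℝ) (A B : Matrix (Fin n) (Fin n) ℂ) :
    Matrix (Fin n) (Fin n) ℂ :=
  Matrix.of fun i j => ∫ s, harmonicMean s A B i j ∂ν

/-- The measure characterizing `x ↦ x ^ t` for `0 < t < 1`
(see `isRepresentingMeasure_rpow`): the measure
`(sin (π t) / π) s ^ (t - 1) (1 - s) ^ (-t) ds` on `(0, 1)`, which is the beta distribution with
parameters `t` and `1 - t`. -/
noncomputable def rpowMeasure (t : ℝ) : Measure ℝ :=
  ProbabilityTheory.betaMeasure t (1 - t)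

/-- The weighted geometric mean `A ♯_t B` for `0 < t < 1`, i.e. the operator mean of the
operator monotone function `x ↦ x ^ t`. -/
noncomputable def geometricMean {n : ℕ} (t : ℝ) (A B : Matrix (Fin n) (Fin n) ℂ) :
    Matrix (Fin n) (Fin n) ℂ :=
  operatorMean (rpowMeasure t) A B

/-- The Heinz mean `(A ♯_t B + A ♯_{1-t} B) / 2` of matrices, for `0 < t < 1`. -/
noncomputable def heinzMean {n : ℕ} (t : ℝ) (A B : Matrix (Fin n) (Fin n) ℂ) :
    Matrix (Fin n) (Fin n) ℂ :=
  (1 / 2 : ℂ) • (geometricMean t A B + geometricMean (1 - t) A B)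

/-- The Heinz mean `(a^{1-t} b^t + a^t b^{1-t}) / 2` of nonnegative real numbers. -/
noncomputable def scalarHeinzMean (t a b : ℝ) : ℝ :=
  (a ^ (1 - t) * b ^ t + a ^ t * b ^ (1 - t)) / 2

theorem isGreatest_numericalRadius {n : ℕ} [NeZero n] (A : Matrix (Fin n) (Fin n) ℂ) :
    IsGreatest ((fun z : ℂ => ‖z‖) '' numericalRange A) (numericalRadius A) := by
  have himg : (fun z : ℂ => ‖z‖) '' numericalRange A =
      (fun x : EuclideanSpace ℂ (Fin n) => ‖(inner ℂ x (Matrix.toEuclideanLin A x) : ℂ)‖) ''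
        Metric.sphere 0 1 := by
    ext r
    simp only [numericalRange, Set.mem_image, Set.mem_ofPred_eq, mem_sphere_zero_iff_norm]
    constructor
    · rintro ⟨z, ⟨x, hx, rfl⟩, rfl⟩
      exact ⟨x, hx, rfl⟩
    · rintro ⟨x, hx, rfl⟩
      exact ⟨_, ⟨x, hx, rfl⟩, rfl⟩
  have hcont : Continuous fun x : EuclideanSpace ℂ (Fin n) =>
      ‖(inner ℂ x (Matrix.toEuclideanLin A x) : ℂ)‖ :=
    (continuous_id.inner (LinearMap.continuous_of_finiteDimensional _)).norm
  unfold numericalRadius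
  rw [himg]
  refine ((isCompact_sphere _ _).image hcont).isGreatest_sSup (Set.Nonempty.image _ ?_)
  exact ⟨EuclideanSpace.single 0 1, by simp⟩

theorem IsAccretive.isUnit_det {n : ℕ} {A : Matrix (Fin n) (Fin n) ℂ} (hA : IsAccretive A) :
    IsUnit A.det := by
  rw [isUnit_iff_ne_zero]
  intro h
  obtain ⟨v, hv, hAv⟩ := Matrix.exists_mulVec_eq_zero_iff.2 h
  have h1 := hA.dotProduct_mulVec_pos hv
  have h2 : star v ⬝ᵥ (Aᴴ *ᵥ v) = 0 := by
    rw [Matrix.dotProduct_mulVec, ← Matrix.star_mulVec, hAv]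
    simp
  rw [hermitianPart, Matrix.smul_mulVec, Matrix.add_mulVec, hAv, zero_add, dotProduct_smul, h2]
    at h1
  simp at h1

theorem IsAccretive.inv {n : ℕ} {A : Matrix (Fin n) (Fin n) ℂ} (hA : IsAccretive A) :
    IsAccretive A⁻¹ := by
  have hu := hA.isUnit_det
  have hu' : IsUnit (Aᴴ).det := by
    rw [Matrix.det_conjTranspose]; exact hu.star
  have key : hermitianPart A⁻¹ = A⁻¹ * hermitianPart A * (A⁻¹)ᴴ := by
    simp only [hermitianPart, Matrix.mul_smul, Matrix.smul_mul, Matrix.mul_add, Matrix.add_mul]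
    rw [Matrix.nonsing_inv_mul _ hu, Matrix.conjTranspose_nonsing_inv, Matrix.mul_assoc A⁻¹ Aᴴ,
      Matrix.mul_nonsing_inv _ hu', Matrix.one_mul, Matrix.mul_one, add_comm]
  unfold IsAccretive at hA ⊢
  rw [key]
  refine hA.mul_mul_conjTranspose_same (B := A⁻¹) ?_
  have : IsUnit A⁻¹ := (Matrix.isUnit_iff_isUnit_det _).2 (Matrix.isUnit_nonsing_inv_det _ hu)
  exact Matrix.vecMul_injective_of_isUnit this

theorem IsAccretive.convexComb {n : ℕ} {P Q : Matrix (Fin n) (Fin n) ℂ} (hP : IsAccretive P)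
    (hQ : IsAccretive Q) {s : ℝ} (hs : s ∈ Set.Icc (0 : ℝ) 1) :
    IsAccretive (((1 - s : ℝ) : ℂ) • P + (s : ℂ) • Q) := by
  have key : hermitianPart (((1 - s : ℝ) : ℂ) • P + (s : ℂ) • Q) =
      (1 - s) • hermitianPart P + s • hermitianPart Q := by
    ext i j
    simp [hermitianPart]
    ring
  unfold IsAccretive at *
  rw [key]
  rcases hs.1.eq_or_lt with h0 | h0
  · simpa [← h0] using hP
  · exact (hQ.smul h0).posSemidef_add (hP.posSemidef.smul (sub_nonneg.2 hs.2))

theorem integrable_harmonicMean {n : ℕ} {A B : Matrix (Fin n) (Fin n) ℂ} (hA : IsAccretive A)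
    (hB : IsAccretive B) (ν : Measure ℝ) [IsFiniteMeasure ν]
    (hν : ν (Set.Icc (0 : ℝ) 1)ᶜ = 0) (i j : Fin n) :
    Integrable (fun s : ℝ => harmonicMean s A B i j) ν := by
  have hM : Continuous fun s : ℝ => ((1 - s : ℝ) : ℂ) • A⁻¹ + (s : ℂ) • B⁻¹ := by fun_prop
  have hcont : ContinuousOn (fun s : ℝ => harmonicMean s A B i j) (Set.Icc 0 1) := by
    have heq : (fun s : ℝ => harmonicMean s A B i j) = fun s : ℝ =>
        (((1 - s : ℝ) : ℂ) • A⁻¹ + (s : ℂ) • B⁻¹).det⁻¹ *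
          (((1 - s : ℝ) : ℂ) • A⁻¹ + (s : ℂ) • B⁻¹).adjugate i j := by
      funext s
      rw [harmonicMean, Matrix.inv_def, Ring.inverse_eq_inv', Matrix.smul_apply, smul_eq_mul]
    rw [heq]
    refine ContinuousOn.mul (ContinuousOn.inv₀ hM.matrix_det.continuousOn fun s hs => ?_)
      (hM.matrix_adjugate.matrix_elem i j).continuousOn
    exact (hA.inv.convexComb hB.inv hs).isUnit_det.ne_zero
  have h := hcont.integrableOn_compact (μ := ν) isCompact_Icc
  rwa [IntegrableOn, Measure.restrict_eq_self_of_ae_mem] at h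
  exact hν

theorem isProbabilityMeasure_rpowMeasure {t : ℝ} (ht : t ∈ Set.Ioo (0 : ℝ) 1) :
    IsProbabilityMeasure (rpowMeasure t) :=
  ProbabilityTheory.isProbabilityMeasureBeta ht.1 (sub_pos.2 ht.2)

theorem rpowMeasure_compl_Icc (t : ℝ) : rpowMeasure t (Set.Icc (0 : ℝ) 1)ᶜ = 0 := by
  rw [rpowMeasure, ProbabilityTheory.betaMeasure,
    withDensity_apply _ measurableSet_Icc.compl,
    setLIntegral_congr_fun (g := fun _ => 0) measurableSet_Icc.compl]
  · simp
  · intro x hx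
    rw [Set.mem_compl_iff, Set.mem_Icc, not_and_or, not_le, not_le] at hx
    rcases hx with hx | hx
    · exact ProbabilityTheory.betaPDF_eq_zero_of_nonpos hx.le
    · exact ProbabilityTheory.betaPDF_eq_zero_of_one_le hx.le

theorem integral_rpowMeasure {t : ℝ} (ht : t ∈ Set.Ioo (0 : ℝ) 1) (g : ℝ → ℝ) :
    ∫ s, g s ∂(rpowMeasure t) = ∫ s in Set.Ioo (0 : ℝ) 1,
      (Real.sin (Real.pi * t) / Real.pi * s ^ (t - 1) * (1 - s) ^ (-t)) * g s := by
  have hbeta : 1 / ProbabilityTheory.beta t (1 - t) = Real.sin (Real.pi * t) / Real.pi := by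
    rw [ProbabilityTheory.beta, add_sub_cancel, Real.Gamma_one, div_one,
      Real.Gamma_mul_Gamma_one_sub, one_div_div]
  have hnn : ∀ x, 0 ≤ ProbabilityTheory.betaPDFReal t (1 - t) x := by
    intro x
    by_cases hx : 0 < x ∧ x < 1
    · exact (ProbabilityTheory.betaPDFReal_pos hx.1 hx.2 ht.1 (sub_pos.2 ht.2)).le
    · simp [ProbabilityTheory.betaPDFReal, hx]
  rw [rpowMeasure, ProbabilityTheory.betaMeasure,
    integral_withDensity_eq_integral_toReal_smul
      (f := ProbabilityTheory.betaPDF t (1 - t))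
      (ProbabilityTheory.measurable_betaPDFReal t (1 - t)).ennreal_ofReal
      (Filter.Eventually.of_forall fun x => ENNReal.ofReal_lt_top),
    ← integral_indicator measurableSet_Ioo]
  congr 1
  funext x
  rw [ProbabilityTheory.betaPDF, ENNReal.toReal_ofReal (hnn x), smul_eq_mul]
  by_cases hx : x ∈ Set.Ioo (0 : ℝ) 1
  · rw [Set.indicator_of_mem hx, ProbabilityTheory.betaPDFReal, if_pos ⟨hx.1, hx.2⟩, hbeta,
      show 1 - t - 1 = -t by ring]
  · rw [Set.indicator_of_notMem hx, ProbabilityTheory.betaPDFReal, if_neg (fun h => hx ⟨h.1, h.2⟩),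
      zero_mul]

theorem isRepresentingMeasure_rpow {t : ℝ} (ht : t ∈ Set.Ioo (0 : ℝ) 1) :
    IsRepresentingMeasure (fun x => x ^ t) (rpowMeasure t) := by
  have hprob := isProbabilityMeasure_rpowMeasure ht
  refine ⟨hprob, rpowMeasure_compl_Icc t, fun x hx => ⟨?_, ?_⟩⟩
  · have hc : ContinuousOn (fun s : ℝ => ((1 - s) + s * x⁻¹)⁻¹) (Set.Icc 0 1) := by
      refine ContinuousOn.inv₀ (by fun_prop) fun s hs => ?_
      rcases hs.1.eq_or_lt with h0 | h0
      · simp [← h0]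
      · have := mul_pos h0 (inv_pos.2 hx)
        have := hs.2
        refine ne_of_gt ?_
        nlinarith
    have h := hc.integrableOn_compact (μ := rpowMeasure t) isCompact_Icc
    rwa [IntegrableOn, Measure.restrict_eq_self_of_ae_mem] at h
    exact rpowMeasure_compl_Icc t
  · have hD : ∀ v ∈ Set.Ioo (0 : ℝ) 1, 0 < (1 - v) + x * v := fun v hv =>
      add_pos (sub_pos.2 hv.2) (mul_pos hx hv.1)
    have himg : (fun v : ℝ => x * v / ((1 - v) + x * v)) '' Set.Ioo (0 : ℝ) 1 =
        Set.Ioo (0 : ℝ) 1 := by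
      ext s
      constructor
      · rintro ⟨v, hv, rfl⟩
        refine ⟨div_pos (mul_pos hx hv.1) (hD v hv), ?_⟩
        rw [div_lt_one (hD v hv)]
        linarith [hv.2]
      · intro hs
        have h1 : 0 < s + x * (1 - s) := add_pos hs.1 (mul_pos hx (sub_pos.2 hs.2))
        refine ⟨s / (s + x * (1 - s)), ⟨div_pos hs.1 h1, ?_⟩, ?_⟩
        · rw [div_lt_one h1]
          linarith [mul_pos hx (sub_pos.2 hs.2)]
        · have h2 : (1 - s / (s + x * (1 - s))) + x * (s / (s + x * (1 - s))) =
              x / (s + x * (1 - s)) := by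
            field_simp
            ring
          simp only [h2]
          field_simp
    have hinj : Set.InjOn (fun v : ℝ => x * v / ((1 - v) + x * v)) (Set.Ioo (0 : ℝ) 1) := by
      intro v hv u hu h
      simp only at h
      rw [div_eq_div_iff (hD v hv).ne' (hD u hu).ne'] at h
      have : x * (v - u) = 0 := by linear_combination h
      rcases mul_eq_zero.1 this with h | h
      · exact absurd h hx.ne'
      · linarith
    have hder : ∀ v ∈ Set.Ioo (0 : ℝ) 1,
        HasDerivWithinAt (fun v : ℝ => x * v / ((1 - v) + x * v))
          (x / ((1 - v) + x * v) ^ 2) (Set.Ioo (0 : ℝ) 1) v := by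
      intro v hv
      have h1 : HasDerivAt (fun v : ℝ => x * v) x v := by
        simpa using (hasDerivAt_id v).const_mul x
      have h2 : HasDerivAt (fun v : ℝ => (1 - v) + x * v) (-1 + x) v :=
        ((hasDerivAt_id v).const_sub 1).add h1
      have h3 := (h1.div h2 (hD v hv).ne').hasDerivWithinAt (s := Set.Ioo (0 : ℝ) 1)
      have h4 : x * ((1 - v) + x * v) - x * v * (-1 + x) = x := by ring
      rwa [h4] at h3
    have hone : ∫ s in Set.Ioo (0 : ℝ) 1,
        Real.sin (Real.pi * t) / Real.pi * s ^ (t - 1) * (1 - s) ^ (-t) = 1 := by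
      have h := integral_rpowMeasure ht (fun _ => 1)
      simpa using h.symm
    rw [integral_rpowMeasure ht]
    conv_rhs => rw [← himg]
    rw [integral_image_eq_integral_abs_deriv_smul measurableSet_Ioo hder hinj,
      setIntegral_congr_fun (g := fun v => x ^ t *
        (Real.sin (Real.pi * t) / Real.pi * v ^ (t - 1) * (1 - v) ^ (-t))) measurableSet_Ioo,
      integral_const_mul, hone, mul_one]
    intro v hv
    have hDv := hD v hv
    have hv0 := hv.1
    have hv1 : 0 < 1 - v := sub_pos.2 hv.2
    set D := (1 - v) + x * v with hDdef
    have e1 : 1 - x * v / D = (1 - v) / D := by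
      field_simp
      rw [hDdef]; ring
    have e2 : ((1 - v) / D + x * v / D * x⁻¹)⁻¹ = D := by
      field_simp
      ring
    simp only [smul_eq_mul]
    rw [e1, e2, abs_of_pos (by positivity), Real.div_rpow (by positivity) hDv.le,
      Real.mul_rpow hx.le hv0.le, Real.div_rpow hv1.le hDv.le,
      Real.rpow_sub_one hx.ne', Real.rpow_sub_one hDv.ne', Real.rpow_neg hDv.le]
    have := (Real.rpow_pos_of_pos hDv t).ne'
    field_simp
    rw [hDdef, mul_comm]

end HeinzSectorial

/-! The exponent three is two factors `sec α` from a Cauchy-Schwarz inequality and one from passing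
from real part to modulus. Put `k = tan α`, so `1 + k ^ 2 = sec² α`.

If `⟨Tx, x⟩` stays in the sector, then `|⟨u, T z⟩|² ≤ (1 + k²) Re ⟨u, T u⟩ Re ⟨z, T z⟩`
(`sq_norm_inner_le_of_sectorial`). For `T = A`, `z = A⁻¹ x`, `u = x` this yields `Re A⁻¹ ≥ cos² α /
w(A)` (`sq_norm_le_re_inner_inv`). Such lower bounds combine linearly, so `M = (1 - s) A⁻¹ + s B⁻¹`
satisfies `Re M ≥ cos² α ((1 - s) / w(A) + s / w(B))`, and inversion bounds `Re M⁻¹` above by `sec²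
α` times the scalar harmonic mean of `w(A)` and `w(B)`. Since `M⁻¹` is again sectorial, moduli cost
one more `sec α` (`norm_inner_harmonicMean_le`).

Integration in `s` turns scalar harmonic means into `w(A)^(1-t) w(B)^t`; averaging over `t` and `1 -
t` gives the Heinz means. -/

namespace HeinzSectorial

/-! ### Cauchy-Schwarz inequalities for sectorial operators -/

section Form

variable {E : Type*} [NormedAddCommGroup E] [InnerProductSpace ℂ E]

/-- The positive semidefinite form `(u, z) ↦ c ⟨u, T z⟩ + c̄ ⟨T u, z⟩`, where `Re c ⟨x, T x⟩ ≥ 0`. -/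
@[reducible]
noncomputable def hermitianFormCore (T : E →ₗ[ℂ] E) (c : ℂ)
    (h : ∀ x : E, 0 ≤ (c * inner ℂ x (T x)).re) : PreInnerProductSpace.Core ℂ E where
  inner u z := c * inner ℂ u (T z) + star c * inner ℂ (T u) z
  conj_inner_symm u z := by
    simp only [map_add, map_mul, inner_conj_symm, Complex.star_def, Complex.conj_conj]
    ring
  re_inner_nonneg x := by
    have h1 := h x
    rw [← inner_conj_symm (T x) x]
    simp only [RCLike.re_to_complex, Complex.star_def, Complex.add_re, Complex.mul_re,
      Complex.conj_re, Complex.conj_im] at h1 ⊢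
    linarith
  add_left u v z := by
    simp only [map_add, inner_add_left]
    ring
  smul_left u v r := by
    simp only [map_smul, inner_smul_left]
    ring

/-- The Cauchy-Schwarz inequality for the form `c ⟨u, T z⟩ + c̄ ⟨T u, z⟩`. -/
theorem sq_norm_hermitianForm_le (T : E →ₗ[ℂ] E) (c : ℂ)
    (h : ∀ x : E, 0 ≤ (c * inner ℂ x (T x)).re) (u z : E) :
    ‖c * inner ℂ u (T z) + star c * inner ℂ (T u) z‖ ^ 2 ≤
      4 * (c * inner ℂ u (T u)).re * (c * inner ℂ z (T z)).re := by
  have key := @InnerProductSpace.Core.inner_mul_inner_self_le ℂ E _ _ _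
    (hermitianFormCore T c h) u z
  have hself : ∀ x : E, (c * inner ℂ x (T x) + star c * inner ℂ (T x) x).re =
      2 * (c * inner ℂ x (T x)).re := by
    intro x
    rw [← inner_conj_symm (T x) x]
    simp only [Complex.star_def, Complex.add_re, Complex.mul_re, Complex.conj_re, Complex.conj_im]
    ring
  have hsymm : ‖c * inner ℂ z (T u) + star c * inner ℂ (T z) u‖ =
      ‖c * inner ℂ u (T z) + star c * inner ℂ (T u) z‖ := by
    rw [← Complex.norm_conj]
    simp only [map_add, map_mul, inner_conj_symm, Complex.star_def, Complex.conj_conj]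
    rw [add_comm]
  change ‖c * inner ℂ u (T z) + star c * inner ℂ (T u) z‖ *
    ‖c * inner ℂ z (T u) + star c * inner ℂ (T z) u‖ ≤
    (c * inner ℂ u (T u) + star c * inner ℂ (T u) u).re *
    (c * inner ℂ z (T z) + star c * inner ℂ (T z) z).re at key
  rw [hsymm, hself, hself] at key
  nlinarith [key]

/-- Merges the Cauchy-Schwarz bounds of two semidefinite forms: the cross term obeys `X Y ≤ 4 √(p s
· q r) ≤ 2 (p s + q r)` by AM-GM. -/
theorem add_sq_le_four_mul_add_mul_add {X Y p q r s : ℝ} (hp : 0 ≤ p) (hq : 0 ≤ q) (hr : 0 ≤ r)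
    (hs : 0 ≤ s) (hX : X ^ 2 ≤ 4 * p * r) (hY : Y ^ 2 ≤ 4 * q * s) :
    (X + Y) ^ 2 ≤ 4 * (p + q) * (r + s) := by
  have h1 : X * Y ≤ 2 * (p * s + q * r) := by
    refine le_of_sq_le_sq ?_ (by positivity)
    calc (X * Y) ^ 2 = X ^ 2 * Y ^ 2 := by ring
      _ ≤ (4 * p * r) * (4 * q * s) := by gcongr
      _ ≤ (2 * (p * s + q * r)) ^ 2 := by nlinarith [sq_nonneg (p * s - q * r)]
  nlinarith

/-- The sharp Cauchy-Schwarz inequality for an operator with numerical range in a sector. -/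
theorem sq_norm_inner_le_of_sectorial (T : E →ₗ[ℂ] E) {k : ℝ} (hk : 0 ≤ k)
    (h : ∀ x : E, |(inner ℂ x (T x)).im| ≤ k * (inner ℂ x (T x)).re)
    (h0 : ∀ x : E, 0 ≤ (inner ℂ x (T x)).re) (u z : E) :
    ‖inner ℂ u (T z)‖ ^ 2 ≤ (1 + k ^ 2) * (inner ℂ u (T u)).re * (inner ℂ z (T z)).re := by
  -- The argument divides by `l ^ 2`, and `k` may be `0`; hence a strictly larger slope, followed by
  -- `l → k`.
  have main : ∀ l : ℝ, k < l →
      ‖inner ℂ u (T z)‖ ^ 2 ≤ (1 + l ^ 2) * (inner ℂ u (T u)).re * (inner ℂ z (T z)).re := by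
    intro l hl
    have hl0 : 0 < l := hk.trans_lt hl
    have hb : ∀ x : E, |(inner ℂ x (T x)).im| ≤ l * (inner ℂ x (T x)).re := fun x =>
      (h x).trans (mul_le_mul_of_nonneg_right hl.le (h0 x))
    -- The sector is an intersection of two half-planes `Re ((l ± i) z) ≥ 0`; each gives a
    -- semidefinite form.
    have hp : ∀ x : E, 0 ≤ (((l : ℂ) + Complex.I) * inner ℂ x (T x)).re := fun x => by
      have := (abs_le.1 (hb x)).2
      simp only [Complex.mul_re, Complex.add_re, Complex.add_im, Complex.ofReal_re,
        Complex.ofReal_im, Complex.I_re, Complex.I_im]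
      linarith
    have hm : ∀ x : E, 0 ≤ (((l : ℂ) - Complex.I) * inner ℂ x (T x)).re := fun x => by
      have := (abs_le.1 (hb x)).1
      simp only [Complex.mul_re, Complex.sub_re, Complex.sub_im, Complex.ofReal_re,
        Complex.ofReal_im, Complex.I_re, Complex.I_im]
      linarith
    have hsum : ∀ x : E, (((l : ℂ) + Complex.I) * inner ℂ x (T x)).re +
        (((l : ℂ) - Complex.I) * inner ℂ x (T x)).re = 2 * l * (inner ℂ x (T x)).re := fun x => by
      simp only [Complex.mul_re, Complex.sub_re, Complex.sub_im, Complex.add_re, Complex.add_im,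
        Complex.ofReal_re, Complex.ofReal_im, Complex.I_re, Complex.I_im]
      ring
    have hX := sq_norm_hermitianForm_le T _ hp u z
    have hY := sq_norm_hermitianForm_le T _ hm u z
    have hXY := add_sq_le_four_mul_add_mul_add (hp u) (hm u) (hp z) (hm z) hX hY
    rw [hsum, hsum] at hXY
    have sp : star ((l : ℂ) + Complex.I) = l - Complex.I := by
      simp [sub_eq_add_neg]
    have sm : star ((l : ℂ) - Complex.I) = l + Complex.I := by
      simp
    rw [sp, sm] at hXY
    set f : ℂ := inner ℂ u (T z)
    set g : ℂ := inner ℂ (T u) z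
    set X : ℂ := ((l : ℂ) + Complex.I) * f + (l - Complex.I) * g
    set Y : ℂ := ((l : ℂ) - Complex.I) * f + (l + Complex.I) * g
    have hnp : ‖(l : ℂ) + Complex.I‖ = √(1 + l ^ 2) := by
      simpa [add_comm] using Complex.norm_add_mul_I l 1
    have hnm : ‖(l : ℂ) - Complex.I‖ = √(1 + l ^ 2) := by
      rw [← hnp, ← Complex.norm_conj]
      simp
    have hf : 4 * l * ‖f‖ ≤ √(1 + l ^ 2) * (‖X‖ + ‖Y‖) := by
      -- This combination eliminates `g`, and `(l + i)² - (l - i)² = 4 l i`.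
      have e : ((l : ℂ) + Complex.I) * X - (l - Complex.I) * Y = 4 * l * Complex.I * f := by
        simp only [X, Y]
        ring
      have h2 := norm_sub_le (((l : ℂ) + Complex.I) * X) ((l - Complex.I) * Y)
      rw [e] at h2
      simp only [norm_mul, hnp, hnm, Complex.norm_I, Complex.norm_real, Real.norm_eq_abs,
        abs_of_pos hl0, Complex.norm_ofNat] at h2
      linarith
    have h3 : (4 * l * ‖f‖) ^ 2 ≤ (√(1 + l ^ 2) * (‖X‖ + ‖Y‖)) ^ 2 := by gcongr
    rw [mul_pow √(1 + l ^ 2), Real.sq_sqrt (by positivity)] at h3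
    have h4 : (1 + l ^ 2) * (‖X‖ + ‖Y‖) ^ 2 ≤ (1 + l ^ 2) *
      (4 * (2 * l * (inner ℂ u (T u)).re) * (2 * l * (inner ℂ z (T z)).re)) := by gcongr
    have h5 : 0 < 16 * l ^ 2 := by positivity
    refine le_of_mul_le_mul_left ?_ h5
    linarith
  have hlim : Filter.Tendsto
      (fun l : ℝ => (1 + l ^ 2) * (inner ℂ u (T u)).re * (inner ℂ z (T z)).re)
      (nhdsWithin k (Set.Ioi k))
      (nhds ((1 + k ^ 2) * (inner ℂ u (T u)).re * (inner ℂ z (T z)).re)) :=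
    tendsto_nhdsWithin_of_tendsto_nhds (Continuous.tendsto (by fun_prop) k)
  exact ge_of_tendsto hlim (eventually_nhdsWithin_of_forall main)

/-- Take `u = T z` in the sectorial Cauchy-Schwarz inequality and cancel one factor `‖T z‖ ^ 2`. -/
theorem sq_norm_apply_le_of_sectorial (T : E →ₗ[ℂ] E) {k a : ℝ} (hk : 0 ≤ k)
    (h : ∀ x : E, |(inner ℂ x (T x)).im| ≤ k * (inner ℂ x (T x)).re)
    (h0 : ∀ x : E, 0 ≤ (inner ℂ x (T x)).re)
    (ha : ∀ x : E, (inner ℂ x (T x)).re ≤ a * ‖x‖ ^ 2) (z : E) :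
    ‖T z‖ ^ 2 ≤ (1 + k ^ 2) * a * (inner ℂ z (T z)).re := by
  have key := sq_norm_inner_le_of_sectorial T hk h h0 (T z) z
  rcases eq_or_ne (T z) 0 with hz | hz
  · simp [hz]
  have hpos : 0 < ‖T z‖ ^ 2 := by positivity
  rw [inner_self_eq_norm_sq_to_K, norm_pow] at key
  simp only [RCLike.norm_ofReal, abs_norm] at key
  refine le_of_mul_le_mul_left ?_ hpos
  calc ‖T z‖ ^ 2 * ‖T z‖ ^ 2 = (‖T z‖ ^ 2) ^ 2 := by ring
    _ ≤ _ := key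
    _ ≤ (1 + k ^ 2) * (a * ‖T z‖ ^ 2) * (inner ℂ z (T z)).re := by
      gcongr
      · exact h0 z
      · exact ha _
    _ = _ := by ring

end Form

/-! ### Numerical radius, inverses and harmonic means -/

section NumericalRange

variable {n : ℕ} {A B : Matrix (Fin n) (Fin n) ℂ}

theorem exists_mem_numericalRange_smul (A : Matrix (Fin n) (Fin n) ℂ)
    {x : EuclideanSpace ℂ (Fin n)} (hx : x ≠ 0) :
    ∃ z ∈ numericalRange A,
      (inner ℂ x (Matrix.toEuclideanLin A x) : ℂ) = ((‖x‖ ^ 2 : ℝ) : ℂ) * z := by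
  have hn : (‖x‖ : ℂ) ≠ 0 := by simpa using hx
  refine ⟨_, ⟨((‖x‖ : ℂ)⁻¹) • x, ?_, rfl⟩, ?_⟩
  · rw [norm_smul, norm_inv, Complex.norm_real, norm_norm, inv_mul_cancel₀ (by simpa using hx)]
  · rw [map_smul, inner_smul_left, inner_smul_right, map_inv₀, Complex.conj_ofReal]
    push_cast
    field_simp

theorem abs_im_inner_le_of_mem_sectorialMatrices {α : ℝ} (hA : A ∈ sectorialMatrices n α)
    (x : EuclideanSpace ℂ (Fin n)) :
    |(inner ℂ x (Matrix.toEuclideanLin A x)).im| ≤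
      Real.tan α * (inner ℂ x (Matrix.toEuclideanLin A x)).re := by
  rcases eq_or_ne x 0 with rfl | hx
  · simp
  obtain ⟨z, hz, h⟩ := exists_mem_numericalRange_smul A hx
  have hs : |z.im| ≤ Real.tan α * z.re := hA hz
  rw [h, Complex.im_ofReal_mul, Complex.re_ofReal_mul, abs_mul, abs_of_nonneg (sq_nonneg _),
    mul_left_comm]
  gcongr

theorem norm_inner_le_numericalRadius (A : Matrix (Fin n) (Fin n) ℂ)
    (x : EuclideanSpace ℂ (Fin n)) :
    ‖(inner ℂ x (Matrix.toEuclideanLin A x) : ℂ)‖ ≤ numericalRadius A * ‖x‖ ^ 2 := by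
  rcases eq_or_ne x 0 with rfl | hx
  · simp
  have : NeZero n := ⟨by rintro rfl; exact hx (Subsingleton.elim _ _)⟩
  obtain ⟨z, hz, h⟩ := exists_mem_numericalRange_smul A hx
  have := (isGreatest_numericalRadius A).2 ⟨z, hz, rfl⟩
  rw [h, norm_mul, Complex.norm_real, Real.norm_of_nonneg (sq_nonneg _), mul_comm]
  gcongr

theorem re_inner_hermitianPart (A : Matrix (Fin n) (Fin n) ℂ) (x : EuclideanSpace ℂ (Fin n)) :
    (inner ℂ x (Matrix.toEuclideanLin (hermitianPart A) x)).re =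
      (inner ℂ x (Matrix.toEuclideanLin A x)).re := by
  rw [hermitianPart, map_smul, map_add, Matrix.toEuclideanLin_conjTranspose_eq_adjoint,
    LinearMap.smul_apply, LinearMap.add_apply, inner_smul_right, inner_add_right,
    LinearMap.adjoint_inner_right, ← inner_conj_symm (Matrix.toEuclideanLin A x) x,
    Complex.add_conj]
  norm_num
  ring

theorem IsAccretive.re_inner_pos (hA : IsAccretive A) {x : EuclideanSpace ℂ (Fin n)}
    (hx : x ≠ 0) : 0 < (inner ℂ x (Matrix.toEuclideanLin A x)).re := by
  have hx' : x.ofLp ≠ 0 := by simpa using hx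
  have h := hA.dotProduct_mulVec_pos hx'
  rw [← re_inner_hermitianPart, EuclideanSpace.inner_eq_star_dotProduct, dotProduct_comm]
  exact (Complex.lt_def.1 h).1

theorem IsAccretive.re_inner_nonneg (hA : IsAccretive A) (x : EuclideanSpace ℂ (Fin n)) :
    0 ≤ (inner ℂ x (Matrix.toEuclideanLin A x)).re := by
  rcases eq_or_ne x 0 with rfl | hx
  · simp
  · exact (hA.re_inner_pos hx).le

theorem IsAccretive.numericalRadius_pos [NeZero n] (hA : IsAccretive A) :
    0 < numericalRadius A := by
  have hx : ‖EuclideanSpace.single (0 : Fin n) (1 : ℂ)‖ = 1 := by simp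
  have hpos := hA.re_inner_pos (x := EuclideanSpace.single (0 : Fin n) (1 : ℂ))
    (norm_ne_zero_iff.1 (by rw [hx]; exact one_ne_zero))
  have h := norm_inner_le_numericalRadius A (EuclideanSpace.single (0 : Fin n) (1 : ℂ))
  rw [hx, one_pow, mul_one] at h
  exact hpos.trans_le ((Complex.re_le_norm _).trans h)

theorem toEuclideanLin_mul_inv_apply (hA : IsUnit A.det) (x : EuclideanSpace ℂ (Fin n)) :
    Matrix.toEuclideanLin A (Matrix.toEuclideanLin A⁻¹ x) = x := by
  rw [← LinearMap.comp_apply, ← Matrix.toLpLin_mul_same, Matrix.mul_nonsing_inv _ hA]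
  simp

/-- Substituting `x = A y` shows that the quadratic form of `A⁻¹` takes conjugates of values of that
of `A`. The sector is symmetric under conjugation, so inversion preserves it. -/
theorem inner_toEuclideanLin_inv (hA : IsUnit A.det) (x : EuclideanSpace ℂ (Fin n)) :
    inner ℂ x (Matrix.toEuclideanLin A⁻¹ x) =
      (starRingEnd ℂ) (inner ℂ (Matrix.toEuclideanLin A⁻¹ x)
        (Matrix.toEuclideanLin A (Matrix.toEuclideanLin A⁻¹ x))) := by
  rw [inner_conj_symm, toEuclideanLin_mul_inv_apply hA]

/-- If `A` has numerical range in the sector `{|Im z| ≤ k Re z}`, then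
`‖x‖ ^ 2 ≤ (1 + k ^ 2) w(A) Re ⟨A⁻¹ x, x⟩`. -/
theorem sq_norm_le_re_inner_inv {k : ℝ} (hk : 0 ≤ k) (hA : IsAccretive A)
    (h : ∀ x, |(inner ℂ x (Matrix.toEuclideanLin A x)).im| ≤
      k * (inner ℂ x (Matrix.toEuclideanLin A x)).re) (x : EuclideanSpace ℂ (Fin n)) :
    ‖x‖ ^ 2 ≤
      (1 + k ^ 2) * numericalRadius A * (inner ℂ x (Matrix.toEuclideanLin A⁻¹ x)).re := by
  have key := sq_norm_apply_le_of_sectorial (Matrix.toEuclideanLin A) hk h hA.re_inner_nonneg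
    (fun x => (Complex.re_le_norm _).trans (norm_inner_le_numericalRadius A x))
    (Matrix.toEuclideanLin A⁻¹ x)
  rw [inner_toEuclideanLin_inv hA.isUnit_det, Complex.conj_re]
  rwa [toEuclideanLin_mul_inv_apply hA.isUnit_det] at key ⊢

theorem abs_im_inner_inv_le {k : ℝ} (hA : IsUnit A.det)
    (h : ∀ x, |(inner ℂ x (Matrix.toEuclideanLin A x)).im| ≤
      k * (inner ℂ x (Matrix.toEuclideanLin A x)).re) (x : EuclideanSpace ℂ (Fin n)) :
    |(inner ℂ x (Matrix.toEuclideanLin A⁻¹ x)).im| ≤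
      k * (inner ℂ x (Matrix.toEuclideanLin A⁻¹ x)).re := by
  rw [inner_toEuclideanLin_inv hA, Complex.conj_im, Complex.conj_re, abs_neg]
  exact h _

/-- A lower bound `Re ⟨M x, x⟩ ≥ c ‖x‖ ^ 2` bounds the real part of the inverse from above. -/
theorem re_inner_inv_le {c : ℝ} (hc : 0 < c) (hA : IsUnit A.det)
    (h : ∀ x : EuclideanSpace ℂ (Fin n),
      c * ‖x‖ ^ 2 ≤ (inner ℂ x (Matrix.toEuclideanLin A x)).re)
    (x : EuclideanSpace ℂ (Fin n)) :
    (inner ℂ x (Matrix.toEuclideanLin A⁻¹ x)).re ≤ c⁻¹ * ‖x‖ ^ 2 := by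
  set y := Matrix.toEuclideanLin A⁻¹ x with hy
  have h1 : (inner ℂ x y).re = (inner ℂ y (Matrix.toEuclideanLin A y)).re := by
    rw [hy, inner_toEuclideanLin_inv hA, Complex.conj_re]
  have h2 : (inner ℂ x y).re ≤ ‖x‖ * ‖y‖ :=
    (Complex.re_le_norm _).trans (norm_inner_le_norm x y)
  have h3 := h y
  rw [← h1] at h3
  -- Cancel `‖y‖` in `c ‖y‖² ≤ Re ⟨x, y⟩ ≤ ‖x‖ ‖y‖`.
  have h4 : c * ‖y‖ ≤ ‖x‖ := by
    rcases (norm_nonneg y).eq_or_lt with h0 | h0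
    · rw [← h0, mul_zero]
      exact norm_nonneg x
    · refine le_of_mul_le_mul_right ?_ h0
      linarith
  calc (inner ℂ x y).re ≤ ‖x‖ * ‖y‖ := h2
    _ ≤ ‖x‖ * (c⁻¹ * ‖x‖) := by
      gcongr
      rwa [le_inv_mul_iff₀ hc]
    _ = c⁻¹ * ‖x‖ ^ 2 := by ring

theorem inner_convexComb (P Q : Matrix (Fin n) (Fin n) ℂ) (s : ℝ)
    (x : EuclideanSpace ℂ (Fin n)) :
    inner ℂ x (Matrix.toEuclideanLin (((1 - s : ℝ) : ℂ) • P + (s : ℂ) • Q) x) =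
      ((1 - s : ℝ) : ℂ) * inner ℂ x (Matrix.toEuclideanLin P x) +
        (s : ℂ) * inner ℂ x (Matrix.toEuclideanLin Q x) := by
  simp only [map_add, map_smul, LinearMap.add_apply, LinearMap.smul_apply, inner_add_right,
    inner_smul_right]

/-- The right side is `sec³ α` times the harmonic mean of the two radii, written with `w(A)`
factored out to match the integrand representing `x ^ t` at `x = w(B) / w(A)`. -/
theorem norm_inner_harmonicMean_le [NeZero n] {k : ℝ} (hk : 0 ≤ k) (hA : IsAccretive A)
    (hB : IsAccretive B)
    (hAk : ∀ x, |(inner ℂ x (Matrix.toEuclideanLin A x)).im| ≤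
      k * (inner ℂ x (Matrix.toEuclideanLin A x)).re)
    (hBk : ∀ x, |(inner ℂ x (Matrix.toEuclideanLin B x)).im| ≤
      k * (inner ℂ x (Matrix.toEuclideanLin B x)).re)
    {s : ℝ} (hs : s ∈ Set.Icc (0 : ℝ) 1) {x : EuclideanSpace ℂ (Fin n)} (hx : ‖x‖ = 1) :
    ‖(inner ℂ x (Matrix.toEuclideanLin (harmonicMean s A B) x) : ℂ)‖ ≤
      √(1 + k ^ 2) ^ 3 *
        (numericalRadius A *
          ((1 - s) + s * (numericalRadius B / numericalRadius A)⁻¹)⁻¹) := by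
  have ha := hA.numericalRadius_pos
  have hb := hB.numericalRadius_pos
  have hu := (hA.inv.convexComb hB.inv hs).isUnit_det
  have hs0 := hs.1
  have hs1 : 0 ≤ 1 - s := sub_nonneg.2 hs.2
  have hK : 0 < 1 + k ^ 2 := by positivity
  have hd : 0 < (1 - s) / numericalRadius A + s / numericalRadius B := by
    rcases hs0.eq_or_lt with h | h
    · rw [← h]; simpa using ha
    · positivity
  have him : ∀ y : EuclideanSpace ℂ (Fin n), |(inner ℂ y (Matrix.toEuclideanLin
      (((1 - s : ℝ) : ℂ) • A⁻¹ + (s : ℂ) • B⁻¹) y)).im| ≤ k * (inner ℂ y (Matrix.toEuclideanLin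
      (((1 - s : ℝ) : ℂ) • A⁻¹ + (s : ℂ) • B⁻¹) y)).re := by
    intro y
    have h1 := abs_im_inner_inv_le hA.isUnit_det hAk y
    have h2 := abs_im_inner_inv_le hB.isUnit_det hBk y
    rw [inner_convexComb, Complex.add_im, Complex.add_re, Complex.im_ofReal_mul,
      Complex.im_ofReal_mul, Complex.re_ofReal_mul, Complex.re_ofReal_mul]
    refine (abs_add_le _ _).trans ?_
    rw [abs_mul, abs_mul, abs_of_nonneg hs0, abs_of_nonneg hs1]
    nlinarith [mul_le_mul_of_nonneg_left h1 hs1, mul_le_mul_of_nonneg_left h2 hs0]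
  have hre : ∀ y : EuclideanSpace ℂ (Fin n),
      ((1 + k ^ 2)⁻¹ * ((1 - s) / numericalRadius A + s / numericalRadius B)) * ‖y‖ ^ 2 ≤
        (inner ℂ y (Matrix.toEuclideanLin
          (((1 - s : ℝ) : ℂ) • A⁻¹ + (s : ℂ) • B⁻¹) y)).re := by
    intro y
    have h1 := sq_norm_le_re_inner_inv hk hA hAk y
    have h2 := sq_norm_le_re_inner_inv hk hB hBk y
    rw [← inv_mul_le_iff₀ (by positivity)] at h1 h2
    rw [inner_convexComb, Complex.add_re, Complex.re_ofReal_mul, Complex.re_ofReal_mul]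
    refine le_trans (le_of_eq ?_)
      (add_le_add (mul_le_mul_of_nonneg_left h1 hs1) (mul_le_mul_of_nonneg_left h2 hs0))
    rw [mul_inv, mul_inv]
    ring
  have h1 := re_inner_inv_le (by positivity) hu hre x
  have h2 := abs_im_inner_inv_le hu him x
  rw [← harmonicMean] at h1 h2
  rw [hx, one_pow, mul_one] at h1
  set w : ℂ := inner ℂ x (Matrix.toEuclideanLin (harmonicMean s A B) x)
  -- The third factor `sec α`: in the sector, `|w|² ≤ (1 + k²) (Re w)²`.
  have hw : ‖w‖ ≤ √(1 + k ^ 2) * ‖w.re‖ := by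
    refine le_of_sq_le_sq ?_ (by positivity)
    rw [mul_pow, Real.sq_sqrt hK.le, Complex.sq_norm, Complex.normSq_apply, Real.norm_eq_abs,
      sq_abs]
    nlinarith [pow_le_pow_left₀ (abs_nonneg w.im) h2 2, sq_abs w.im]
  have hw0 : 0 ≤ w.re := by
    have := (hA.inv.convexComb hB.inv hs).inv.re_inner_nonneg x
    rwa [← harmonicMean] at this
  rw [Real.norm_of_nonneg hw0] at hw
  refine hw.trans ((mul_le_mul_of_nonneg_left h1 (Real.sqrt_nonneg _)).trans (le_of_eq ?_))
  rw [pow_succ' _ 2, Real.sq_sqrt hK.le, mul_assoc]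
  congr 1
  rw [mul_inv, inv_inv]
  congr 1
  rw [← mul_inv_cancel_left₀ ha.ne' (((1 - s) / numericalRadius A + s / numericalRadius B)⁻¹),
    ← mul_inv]
  congr 2
  field_simp

end NumericalRange

/-! ### Integration against the representing measure -/

section Integration

variable {n : ℕ} {A B : Matrix (Fin n) (Fin n) ℂ}

theorem inner_operatorMean (hA : IsAccretive A) (hB : IsAccretive B) (ν : Measure ℝ)
    [IsFiniteMeasure ν] (hν : ν (Set.Icc (0 : ℝ) 1)ᶜ = 0) (x : EuclideanSpace ℂ (Fin n)) :
    inner ℂ x (Matrix.toEuclideanLin (operatorMean ν A B) x) =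
      ∫ s, inner ℂ x (Matrix.toEuclideanLin (harmonicMean s A B) x) ∂ν := by
  have hint := integrable_harmonicMean hA hB ν hν
  -- The mean is integrated entrywise, so the form is expanded as a finite linear combination of
  -- entries.
  have hexp : ∀ C : Matrix (Fin n) (Fin n) ℂ, inner ℂ x (Matrix.toEuclideanLin C x) =
      ∑ i, ∑ j, C i j * (x j * star (x i)) := by
    intro C
    simp only [EuclideanSpace.inner_eq_star_dotProduct, Matrix.toLpLin_apply, dotProduct,
      Matrix.mulVec, Finset.sum_mul, Pi.star_apply, mul_assoc]
  simp only [hexp]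
  rw [integral_finsetSum _ fun i _ =>
    integrable_finsetSum _ fun j _ => (hint i j).mul_const _]
  refine Finset.sum_congr rfl fun i _ => ?_
  rw [integral_finsetSum _ fun j _ => (hint i j).mul_const _]
  refine Finset.sum_congr rfl fun j _ => ?_
  rw [integral_mul_const]
  rfl

theorem norm_inner_geometricMean_le [NeZero n] {k : ℝ} (hk : 0 ≤ k) (hA : IsAccretive A)
    (hB : IsAccretive B)
    (hAk : ∀ x, |(inner ℂ x (Matrix.toEuclideanLin A x)).im| ≤
      k * (inner ℂ x (Matrix.toEuclideanLin A x)).re)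
    (hBk : ∀ x, |(inner ℂ x (Matrix.toEuclideanLin B x)).im| ≤
      k * (inner ℂ x (Matrix.toEuclideanLin B x)).re)
    {t : ℝ} (ht : t ∈ Set.Ioo (0 : ℝ) 1) {x : EuclideanSpace ℂ (Fin n)} (hx : ‖x‖ = 1) :
    ‖(inner ℂ x (Matrix.toEuclideanLin (geometricMean t A B) x) : ℂ)‖ ≤
      √(1 + k ^ 2) ^ 3 * (numericalRadius A ^ (1 - t) * numericalRadius B ^ t) := by
  have ha := hA.numericalRadius_pos
  have hb := hB.numericalRadius_pos
  have hrep := isRepresentingMeasure_rpow ht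
  have := hrep.1
  -- At this point the represented value is `w(A) (w(B) / w(A))^t = w(A)^(1-t) w(B)^t`.
  obtain ⟨hint, heq⟩ := hrep.2.2 _ (div_pos hb ha)
  rw [geometricMean, inner_operatorMean hA hB _ (rpowMeasure_compl_Icc t)]
  have hmem : ∀ᵐ s ∂(rpowMeasure t), s ∈ Set.Icc (0 : ℝ) 1 := rpowMeasure_compl_Icc t
  have hle : ∀ᵐ s ∂(rpowMeasure t),
      ‖(inner ℂ x (Matrix.toEuclideanLin (harmonicMean s A B) x) : ℂ)‖ ≤
        √(1 + k ^ 2) ^ 3 * (numericalRadius A *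
          ((1 - s) + s * (numericalRadius B / numericalRadius A)⁻¹)⁻¹) := by
    filter_upwards [hmem] with s hs
    exact norm_inner_harmonicMean_le hk hA hB hAk hBk hs hx
  refine (norm_integral_le_of_norm_le ((hint.const_mul _).const_mul _) hle).trans (le_of_eq ?_)
  rw [integral_const_mul, integral_const_mul, ← heq]
  simp only [Real.div_rpow hb.le ha.le, Real.rpow_sub ha, Real.rpow_one]
  ring

end Integration

end HeinzSectorial

/-! ### The Heinz mean inequality -/

theorem mainTheorem11 (n : ℕ) (α : ℝ) (hα₀ : 0 ≤ α) (hα₁ : α < Real.pi / 2)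
    (A B : Matrix (Fin n) (Fin n) ℂ)
    (hA : HeinzSectorial.IsAccretive A) (hB : HeinzSectorial.IsAccretive B)
    (hAα : A ∈ HeinzSectorial.sectorialMatrices n α)
    (hBα : B ∈ HeinzSectorial.sectorialMatrices n α)
    (t : ℝ) (ht₀ : 0 < t) (ht₁ : t < 1) :
    HeinzSectorial.numericalRadius (HeinzSectorial.heinzMean t A B) ≤
      (1 / Real.cos α) ^ 3 *
        HeinzSectorial.scalarHeinzMean t (HeinzSectorial.numericalRadius A)
          (HeinzSectorial.numericalRadius B) := by
  open HeinzSectorial in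
  have hcos : 0 < Real.cos α := Real.cos_pos_of_mem_Ioo ⟨by linarith [Real.pi_pos], hα₁⟩
  rcases Nat.eq_zero_or_pos n with rfl | hn
  -- In dimension zero there are no unit vectors, and `sSup ∅ = 0` makes both sides vanish.
  · have h0 : ∀ C : Matrix (Fin 0) (Fin 0) ℂ, numericalRadius C = 0 := by
      intro C
      have : numericalRange C = ∅ := by
        refine Set.eq_empty_of_forall_notMem ?_
        rintro z ⟨x, hx, -⟩
        rw [Subsingleton.elim x 0, norm_zero] at hx
        exact zero_ne_one hx
      rw [numericalRadius, this, Set.image_empty, Real.sSup_empty]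
    simp only [h0, scalarHeinzMean]
    rw [Real.zero_rpow ht₀.ne']
    simp
  have : NeZero n := ⟨hn.ne'⟩
  have hk : 0 ≤ Real.tan α := Real.tan_nonneg_of_nonneg_of_le_pi_div_two hα₀ hα₁.le
  have hAk := abs_im_inner_le_of_mem_sectorialMatrices hAα
  have hBk := abs_im_inner_le_of_mem_sectorialMatrices hBα
  have hsec : √(1 + Real.tan α ^ 2) = 1 / Real.cos α := by
    rw [← inv_inv (1 + Real.tan α ^ 2), Real.inv_one_add_tan_sq hcos.ne', Real.sqrt_inv,
      Real.sqrt_sq hcos.le, one_div]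
  -- A maximizing unit vector for the Heinz mean; both geometric means are estimated at this same
  -- `x`.
  obtain ⟨z, ⟨x, hx, rfl⟩, hz⟩ := (isGreatest_numericalRadius (heinzMean t A B)).1
  have h1 := norm_inner_geometricMean_le hk hA hB hAk hBk ⟨ht₀, ht₁⟩ hx
  have h2 := norm_inner_geometricMean_le hk hA hB hAk hBk
    (t := 1 - t) ⟨sub_pos.2 ht₁, sub_lt_self 1 ht₀⟩ hx
  rw [sub_sub_cancel] at h2
  rw [← hz, heinzMean, scalarHeinzMean, ← hsec]
  simp only [map_smul, map_add, LinearMap.smul_apply, LinearMap.add_apply, inner_smul_right,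
    inner_add_right, norm_mul]
  have hhalf : ‖(1 / 2 : ℂ)‖ = 1 / 2 := by norm_num
  rw [hhalf]
  linarith [norm_add_le (inner ℂ x (Matrix.toEuclideanLin (geometricMean t A B) x))
    (inner ℂ x (Matrix.toEuclideanLin (geometricMean (1 - t) A B) x))]
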